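/- Let $(X,d,\mathfrak m)$ be a metric measure space: $(X,d)$ is a complete separable metric space and $\mathfrak m$ is a non-negative Borel measure on $X$, finite on balls, with $\operatorname{supp}\mathfrak m = X$. Assume that $(X,d)$ is a geodesic space, i.e. any two points $x,y$ are joined by some $\gamma\in\mathrm{Geo}(X)$, where $\mathrm{Geo}(X)$ is the set of curves $\gamma:[0,1]\to X$ with $d(\gamma_s,\gamma_t)=|s-t|\,d(\gamma_0,\gamma_1)$ for all $s,t$, equipped with the sup distance. Assume that $(X,d,\mathfrak m)$ is essentially non-branching: for all Borel probability measures $\mu_0,\mu_1\ll\mathfrak m$ on $X$ with finite second moment, every Borel probability measure $\eta$ on $\mathrm{Geo}(X)$ for which the law of $\gamma\mapsto(\gamma_0,\gamma_1)$ under $\eta$ minimizes $\int d^2(x,y)\,d\rho(x,y)$ among all couplings $\rho$ of $\mu_0$ and $\mu_1$ is concentrated on a set $\Gamma\subset\mathrm{Geo}(X)$ of non-branching geodesics, meaning that if $\gamma^1,\gamma^2\in\Gamma$ coincide on $[0,t]$ for some $t\in(0,1)$, then $\gamma^1=\gamma^2$. Let $G$ be a compact Lie group acting continuously on $X$ by isometries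 that preserve $\mathfrak m$. Write $G(x)$ for the orbit and $G_x$ for the isotropy group of $x$, and equip the orbit space $X^*=X/G$ with the distance $d^*(G(x),G(y))=\inf\{d(x',y') : x'\in G(x),\ y'\in G(y)\}$. Assume that $(X^*,d^*)$ is isometric to $[-1,1]$, $[0,\infty)$, $\mathbb R$, or the unit circle $\mathbb S^1$ with its arc length distance. Then for every $x_0\in X$ there is $\delta_0>0$ such that for every $0<\delta<\delta_0$ the set $$S_{x_0}:=\{y\in X : d(x_0,y)=d(G(x_0),y)\}\cap B_\delta(x_0)$$ (with $B_\delta(x_0)$ the open ball) is a slice at $x_0$, that is, $x_0\in S_{x_0}$ and, with $G(S)=\{gs : g\in G,\ s\in S\}$: 1. $S_{x_0}$ is closed in $G(S_{x_0})$; 2. $G(S_{x_0})$ is an open neighbourhood of $G(x_0)$; 3. $G_{x_0}(S_{x_0})=S_{x_0}$; 4. if $gS_{x_0}\cap S_{x_0}\neq\emptyset$ for some $g\in G$, then $g\in G_{x_0}$. -/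

import Mathlib

open MeasureTheory Set
open scoped ENNReal Pointwise Manifold ContDiff unitInterval

noncomputable section

namespace CohomogeneityOne

section Geodesics

variable (X : Type*) [MetricSpace X]

/-- `Geo X`: the constant speed minimizing geodesics `γ : [0,1] → X`. -/
def Geo : Type _ :=
  {γ : C(I, X) // ∀ s t : I, dist (γ s) (γ t) = |(s : ℝ) - (t : ℝ)| * dist (γ 0) (γ 1)}

/-- `Geo X` carries the uniform distance. -/
instance : MetricSpace (Geo X) :=
  inferInstanceAs (MetricSpace
    {γ : C(I, X) // ∀ s t : I, dist (γ s) (γ t) = |(s : ℝ) - (t : ℝ)| * dist (γ 0) (γ 1)})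

/-- `Geo X` carries the Borel sigma-algebra of the uniform distance. -/
instance : MeasurableSpace (Geo X) := borel (Geo X)

instance : BorelSpace (Geo X) := ⟨rfl⟩

variable {X}

/-- The evaluation map `e_t : Geo X → X`. -/
def Geo.eval (t : I) (γ : Geo X) : X := γ.1 t

variable (X)

/-- Any two points are joined by a geodesic. -/
def IsGeodesicSpace : Prop :=
  ∀ x y : X, ∃ γ : Geo X, γ.eval 0 = x ∧ γ.eval 1 = y

variable {X}

/-- No two distinct members of `Γ` coincide on an initial interval `[0,t]` with `0 < t < 1`. -/
def IsNonBranchingSet (Γ : Set (Geo X)) : Prop :=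
  ∀ γ₁ ∈ Γ, ∀ γ₂ ∈ Γ,
    (∃ t : I, 0 < t ∧ t < 1 ∧ ∀ s : I, s ≤ t → γ₁.eval s = γ₂.eval s) → γ₁ = γ₂

end Geodesics

section Transport

variable {X : Type*} [MetricSpace X] [MeasurableSpace X]

/-- `μ ∈ ℙ₂(X)`: a probability measure with finite second moment. -/
def MemP2 (μ : Measure X) : Prop :=
  IsProbabilityMeasure μ ∧ ∃ x₀ : X, ∫⁻ x, edist x x₀ ^ 2 ∂μ < ⊤

/-- `ρ` is a measure on `X × X` with marginals `μ₀` and `μ₁`. -/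
def IsCoupling (ρ : Measure (X × X)) (μ₀ μ₁ : Measure X) : Prop :=
  ρ.map Prod.fst = μ₀ ∧ ρ.map Prod.snd = μ₁

/-- The quadratic transport cost of a plan. -/
def quadraticCost (ρ : Measure (X × X)) : ℝ≥0∞ :=
  ∫⁻ p, edist p.1 p.2 ^ 2 ∂ρ

/-- `ρ ∈ Opt(μ₀, μ₁)`: a coupling of least quadratic cost. -/
def IsOptimalCoupling (ρ : Measure (X × X)) (μ₀ μ₁ : Measure X) : Prop :=
  IsCoupling ρ μ₀ μ₁ ∧
    ∀ ρ' : Measure (X × X), IsCoupling ρ' μ₀ μ₁ → quadraticCost ρ ≤ quadraticCost ρ'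

/-- `η ∈ OptGeo(μ₀, μ₁)`: a probability measure on geodesics whose endpoint law
`(e₀, e₁)_# η` is an optimal coupling. -/
def IsOptGeo (η : Measure (Geo X)) (μ₀ μ₁ : Measure X) : Prop :=
  IsProbabilityMeasure η ∧
    IsOptimalCoupling (η.map fun γ => (γ.eval 0, γ.eval 1)) μ₀ μ₁

/-- Every dynamical optimal transport between absolutely continuous measures of finite second
moment is concentrated on a set of non-branching geodesics. -/
def EssentiallyNonBranching (m : Measure X) : Prop :=
  ∀ μ₀ μ₁ : Measure X, MemP2 μ₀ → MemP2 μ₁ → μ₀ ≪ m → μ₁ ≪ m →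
    ∀ η : Measure (Geo X), IsOptGeo η μ₀ μ₁ →
      ∃ Γ : Set (Geo X), IsNonBranchingSet Γ ∧ ∀ᵐ γ ∂η, γ ∈ Γ

end Transport

section Actions

variable (G : Type*) [Group G] {X : Type*} [MetricSpace X] [MulAction G X]

/-- The orbital distance `d*(a, b) = inf {d(x, y) | x ∈ a, y ∈ b}` on the orbit space. -/
def orbitDist (a b : MulAction.orbitRel.Quotient G X) : ℝ :=
  ⨅ p : a.orbit × b.orbit, dist (p.1 : X) (p.2 : X)

variable (X) in
/-- The orbit space with the orbital distance is isometric to `Y`. -/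
def OrbitSpaceIsometricTo (Y : Type*) [MetricSpace Y] : Prop :=
  ∃ f : MulAction.orbitRel.Quotient G X ≃ Y, ∀ a b, dist (f a) (f b) = orbitDist G a b

/-- The saturation `G(S)`. -/
def saturation (S : Set X) : Set X := {y | ∃ g : G, ∃ s ∈ S, y = g • s}

/-- `S` is a slice at `x`. -/
structure IsSlice (x : X) (S : Set X) : Prop where
  mem : x ∈ S
  closed : ∃ C : Set X, IsClosed C ∧ S = C ∩ saturation G S
  isOpen : IsOpen (saturation G S)
  orbit_subset : MulAction.orbit G x ⊆ saturation G S
  stabilizer_smul : {y | ∃ g ∈ MulAction.stabilizer G x, ∃ s ∈ S, y = g • s} = S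
  mem_stabilizer : ∀ g : G, ((g • S) ∩ S).Nonempty → g ∈ MulAction.stabilizer G x

/-- The points of the open ball `B_δ(x)` whose distance to the orbit `G(x)` is realized at `x`. -/
def normalBall (x : X) (δ : ℝ) : Set X :=
  {y | dist x y = Metric.infDist y (MulAction.orbit G x)} ∩ Metric.ball x δ

end Actions

end CohomogeneityOne

end

/-!
That the set of points near `x₀` whose distance to the orbit of `x₀` is realized at `x₀` is closed
in its saturation, that this saturation is open, and that the set is invariant under the isotropy
group hold for every compact group of isometries. The remaining property of a slice says that a
point `y` near the orbit of `x₀` has only one nearest point on this orbit.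

So suppose that `x₁ ≠ x₂` are nearest points of `y` on one orbit, and let `P : X → Y` be the
projection to the orbit space. As `Y` is one-dimensional, the segment from `P x₁` to `P y` extends beyond `P y` to
some `w`, if `y` is close enough to the orbit: the ball around `P x₁` just has to avoid boundary
points other than `P x₁` itself, and the antipode of `P x₁` in the circle. Let `z` be a point over
`w` nearest to `y`. Since `P` does not increase distances, the concatenations of geodesics from
`x₁` and `x₂` to `y` with one geodesic from `y` to `z` are again geodesics `γ₁`, `γ₂`
(`dist_concat`). They agree beyond `y` and differ near their initial points: run backwards, they
branch.

To contradict *essential* non-branching, the branching has to be seen by an optimal transport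
between absolutely continuous measures
(`EssentiallyNonBranching.false_of_isometries`). The points over the open segment from `P x₁` to
`w` form an open set `V`, on which the orbit of a point is determined by the distance `h` to the
orbit of `x₁`. Let `μ₀` be the normalized restriction of `m` to the part of `V` where `h > h y`, and
`μ₁` the one to the part where `h` is so small that `γ₁` and `γ₂` are apart. Take an optimal coupling
`π` of the images of `μ₀` and `μ₁` under `h`, which are measures on a compact interval
(`exists_isOptimalCoupling`). Choose `(a, b)` according to `π` and `g` in `G` according to the Haar
measure, and move along `g γ₁` or `g γ₂`, each with probability one half, from the parameter `a` to
`b`. Since `μ₀` and `μ₁` are invariant under `G`, these are the distributions of the end points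
(`map_smul_prod_map_eq`); as `h` is `1`-Lipschitz and the cost is that of `π`, the transport is
optimal (`isOptimalCoupling_of_lipschitzWith`). Yet almost every choice of `(g, a, b)` yields two
distinct geodesics with a common initial piece, so no set of non-branching geodesics carries the
transport.
-/

namespace CohomogeneityOne

/-! ### Extending segments in the four model spaces -/

section ModelSpaces

variable {Y : Type*} [MetricSpace Y]

/-- The points strictly between `c` and `w` for the metric: those for which the triangle
inequality is an equality, the end points being excluded. -/
def openMetricSegment (c w : Y) : Set Y :=
  {q | dist c q + dist q w = dist c w ∧ q ≠ c ∧ q ≠ w}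

/-- Every point close to `c` lies strictly between `c` and some `w` for which the points between
`c` and `w` form an open set and are determined by their distance to `c`. This is all that is used
about the orbit space. -/
def HasExtendableSegments (c : Y) : Prop :=
  ∃ δ₀ : ℝ, 0 < δ₀ ∧ ∀ q, q ≠ c → dist c q < δ₀ → ∃ w, q ∈ openMetricSegment c w ∧
    IsOpen (openMetricSegment c w) ∧ InjOn (dist c) (openMetricSegment c w)

theorem mem_openMetricSegment_iff_of_isometry {e : Y → ℝ} (he : Isometry e) (c w q : Y) :
    q ∈ openMetricSegment c w ↔ e c < e q ∧ e q < e w ∨ e w < e q ∧ e q < e c := by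
  simp only [openMetricSegment, mem_ofPred_eq, ← he.dist_eq, Real.dist_eq, ne_eq,
    ← he.injective.eq_iff]
  constructor
  · rintro ⟨h, h1, h2⟩
    rcases lt_or_gt_of_ne h1 with h1 | h1 <;> rcases lt_or_gt_of_ne h2 with h2 | h2 <;>
      rcases abs_cases (e c - e q) with h3 | h3 <;> rcases abs_cases (e q - e w) with h4 | h4 <;>
      rcases abs_cases (e c - e w) with h5 | h5 <;>
      first
        | (left; constructor <;> linarith)
        | (right; constructor <;> linarith)
  · rintro (⟨h1, h2⟩ | ⟨h1, h2⟩)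
    · refine ⟨?_, by linarith, by linarith⟩
      rw [abs_of_neg (by linarith), abs_of_neg (by linarith), abs_of_neg (by linarith)]
      ring
    · refine ⟨?_, by linarith, by linarith⟩
      rw [abs_of_pos (by linarith), abs_of_pos (by linarith), abs_of_pos (by linarith)]
      ring

theorem hasExtendableSegments_of_isometry {e : Y → ℝ} (he : Isometry e) {c : Y} {δ : ℝ}
    (hδ : 0 < δ) (hright : ∀ q, e c < e q → e q < e c + δ → ∃ w, e q < e w)
    (hleft : ∀ q, e q < e c → e c - δ < e q → ∃ w, e w < e q) :
    HasExtendableSegments c := by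
  have hopen : ∀ w, IsOpen (openMetricSegment c w) := by
    intro w
    have : openMetricSegment c w = e ⁻¹' (Ioo (e c) (e w) ∪ Ioo (e w) (e c)) := by
      ext q
      rw [mem_openMetricSegment_iff_of_isometry he]
      rfl
    rw [this]
    exact (isOpen_Ioo.union isOpen_Ioo).preimage he.continuous
  have hinj : ∀ w, InjOn (dist c) (openMetricSegment c w) := by
    intro w q₁ h₁ q₂ h₂ h
    rw [mem_openMetricSegment_iff_of_isometry he] at h₁ h₂
    simp only [← he.dist_eq, Real.dist_eq] at h
    apply he.injective
    rcases abs_cases (e c - e q₁) with h3 | h3 <;> rcases abs_cases (e c - e q₂) with h4 | h4 <;>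
      rcases h₁ with h₁ | h₁ <;> rcases h₂ with h₂ | h₂ <;> linarith
  refine ⟨δ, hδ, fun q hq hd => ?_⟩
  rw [← he.dist_eq, Real.dist_eq, abs_lt] at hd
  rcases lt_or_gt_of_ne (fun h => hq (he.injective h) : e q ≠ e c) with h | h
  · obtain ⟨w, hw⟩ := hleft q h (by linarith)
    exact ⟨w, (mem_openMetricSegment_iff_of_isometry he _ _ _).2 (.inr ⟨hw, h⟩), hopen w, hinj w⟩
  · obtain ⟨w, hw⟩ := hright q h (by linarith)
    exact ⟨w, (mem_openMetricSegment_iff_of_isometry he _ _ _).2 (.inl ⟨h, hw⟩), hopen w, hinj w⟩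

theorem hasExtendableSegments_real (c : ℝ) : HasExtendableSegments c :=
  hasExtendableSegments_of_isometry isometry_id one_pos (fun q _ _ => ⟨q + 1, by simp⟩)
    (fun q _ _ => ⟨q - 1, by simp⟩)

theorem hasExtendableSegments_Ici (c : Ici (0 : ℝ)) : HasExtendableSegments c := by
  have hc : (0 : ℝ) ≤ c := c.2
  -- Any `δ` will do at the end point `0`; elsewhere the ball must avoid `0`.
  obtain ⟨δ, hδ, h⟩ : ∃ δ : ℝ, 0 < δ ∧ ((c : ℝ) = 0 ∨ δ ≤ c) := by
    rcases hc.eq_or_lt with h | h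
    · exact ⟨1, one_pos, .inl h.symm⟩
    · exact ⟨c, h, .inr le_rfl⟩
  refine hasExtendableSegments_of_isometry isometry_subtype_coe hδ
    (fun q _ _ => ⟨⟨q + 1, by have : (0 : ℝ) ≤ q := q.2; simp only [mem_Ici]; linarith⟩, by simp⟩)
    (fun q h1 h2 => ⟨⟨0, by simp⟩, ?_⟩)
  have : (0 : ℝ) ≤ q := q.2
  rcases h with h | h <;> simp only <;> linarith

theorem hasExtendableSegments_Icc (c : Icc (-1 : ℝ) 1) : HasExtendableSegments c := by
  have hc := c.2
  obtain ⟨δ, hδ, h⟩ : ∃ δ : ℝ, 0 < δ ∧ ((c : ℝ) = -1 ∨ δ ≤ c + 1) := by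
    rcases hc.1.eq_or_lt with h | h
    · exact ⟨1, one_pos, .inl h.symm⟩
    · exact ⟨c + 1, by linarith, .inr le_rfl⟩
  obtain ⟨δ', hδ', h'⟩ : ∃ δ : ℝ, 0 < δ ∧ ((c : ℝ) = 1 ∨ δ ≤ 1 - c) := by
    rcases hc.2.eq_or_lt with h | h
    · exact ⟨1, one_pos, .inl h⟩
    · exact ⟨1 - c, by linarith, .inr le_rfl⟩
  refine hasExtendableSegments_of_isometry isometry_subtype_coe (lt_min hδ hδ')
    (fun q h1 h2 => ⟨⟨1, by simp⟩, ?_⟩) (fun q h1 h2 => ⟨⟨-1, by simp⟩, ?_⟩)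
  · have := q.2.2
    have := min_le_right δ δ'
    rcases h' with h' | h' <;> simp only <;> linarith
  · have := q.2.1
    have := min_le_left δ δ'
    rcases h with h | h <;> simp only <;> linarith

theorem norm_coe_addCircle_two_pi (x : ℝ) (hx : |x| ≤ 2 * Real.pi) :
    ‖(x : AddCircle (2 * Real.pi))‖ = min |x| (2 * Real.pi - |x|) := by
  have hpi := Real.pi_pos
  have hp : (2 * Real.pi) ≠ 0 := by positivity
  have key : ∀ z : ℝ, |z| ≤ Real.pi → ‖(z : AddCircle (2 * Real.pi))‖ = |z| := fun z hz =>
    (AddCircle.norm_coe_eq_abs_iff (p := 2 * Real.pi) hp).2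
      (by rw [abs_of_pos (by linarith : 0 < 2 * Real.pi)]; linarith)
  rcases le_total |x| Real.pi with h | h
  · rw [key x h, min_eq_left (by linarith)]
  · rw [min_eq_right (by linarith)]
    rcases abs_cases x with ⟨h1, h2⟩ | ⟨h1, h2⟩
    · rw [← norm_neg, ← AddCircle.coe_neg, ← AddCircle.coe_add_period, key, abs_of_nonneg]
      · rw [h1]; ring
      · linarith
      · rw [abs_le]; constructor <;> linarith
    · rw [← AddCircle.coe_add_period, key, abs_of_nonneg]
      · rw [h1]; ring
      · linarith
      · rw [abs_le]; constructor <;> linarith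

theorem hasExtendableSegments_addCircle (c : AddCircle (2 * Real.pi)) :
    HasExtendableSegments c := by
  have hpi := Real.pi_pos
  have : Fact (0 < 2 * Real.pi) := ⟨by positivity⟩
  have hrep : ∀ q : AddCircle (2 * Real.pi), ∃ t : ℝ, |t| ≤ Real.pi ∧ q = c + (t : ℝ) := by
    intro q
    obtain ⟨⟨t, ht⟩, h⟩ :=
      (AddCircle.equivIoc (2 * Real.pi) (-Real.pi)).symm.surjective (q - c)
    refine ⟨t, abs_le.2 ⟨ht.1.le, by linarith [ht.2]⟩, ?_⟩
    rw [← sub_eq_iff_eq_add', ← h]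
    rfl
  have hdist : ∀ s t : ℝ, |s - t| ≤ 2 * Real.pi →
      dist (c + (s : AddCircle (2 * Real.pi))) (c + (t : ℝ)) =
        min |s - t| (2 * Real.pi - |s - t|) := by
    intro s t h
    rw [dist_add_left, dist_eq_norm, ← AddCircle.coe_sub, norm_coe_addCircle_two_pi _ h]
  have hdist0 : ∀ t : ℝ, |t| ≤ Real.pi →
      dist c (c + (t : AddCircle (2 * Real.pi))) = |t| := by
    intro t ht
    have := hdist 0 t (by rw [zero_sub, abs_neg]; linarith)
    rwa [AddCircle.coe_zero, add_zero, zero_sub, abs_neg, min_eq_left (by linarith)] at this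
  -- For `0 < |R| < π` the metric segment from `c` to `c + R` is the corresponding arc.
  have hseg : ∀ R t : ℝ, |R| < Real.pi → |t| ≤ Real.pi →
      (c + (t : AddCircle (2 * Real.pi)) ∈ openMetricSegment c (c + (R : ℝ)) ↔
        0 < t ∧ t < R ∨ R < t ∧ t < 0) := by
    intro R t hR ht
    have hR' := abs_lt.1 hR
    have ht' := abs_le.1 ht
    have hle : |t - R| ≤ 2 * Real.pi := by rw [abs_le]; constructor <;> linarith
    have hc : c + (t : AddCircle (2 * Real.pi)) ≠ c ↔ t ≠ 0 := by
      rw [not_iff_not, eq_comm, ← dist_eq_zero, hdist0 t ht, abs_eq_zero]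
    have hw : c + (t : AddCircle (2 * Real.pi)) ≠ c + (R : ℝ) ↔ t ≠ R := by
      have h2 : 0 < 2 * Real.pi - |t - R| := by
        rw [sub_pos, abs_lt]; constructor <;> linarith
      rw [not_iff_not, ← dist_eq_zero, hdist t R hle, ← sub_eq_zero (a := t),
        ← abs_eq_zero (a := t - R)]
      constructor
      · intro h
        rcases min_choice |t - R| (2 * Real.pi - |t - R|) with h' | h' <;> rw [h'] at h <;>
          linarith
      · intro h
        rw [min_eq_left (by linarith), h]
    rw [openMetricSegment, mem_ofPred_eq, hc, hw, hdist0 t ht, hdist0 R hR.le, hdist t R hle]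
    constructor
    · rintro ⟨h, h1, h2⟩
      rcases lt_or_gt_of_ne h1 with h1 | h1 <;> rcases lt_or_gt_of_ne h2 with h2 | h2 <;>
        rcases min_choice |t - R| (2 * Real.pi - |t - R|) with h' | h' <;>
        rcases abs_cases t with h3 | h3 <;> rcases abs_cases R with h4 | h4 <;>
        rcases abs_cases (t - R) with h5 | h5 <;>
        first
          | (left; constructor <;> linarith)
          | (right; constructor <;> linarith)
    · rintro (⟨h1, h2⟩ | ⟨h1, h2⟩)
      · rw [abs_of_pos h1, abs_of_neg (sub_neg.2 h2), abs_of_pos (h1.trans h2),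
          min_eq_left (by linarith)]
        exact ⟨by ring, h1.ne', h2.ne⟩
      · rw [abs_of_neg h2, abs_of_pos (sub_pos.2 h1), abs_of_neg (h1.trans h2),
          min_eq_left (by linarith)]
        exact ⟨by ring, h2.ne, h1.ne'⟩
  refine ⟨Real.pi, hpi, fun q hq hd => ?_⟩
  obtain ⟨r, hr, rfl⟩ := hrep q
  rw [hdist0 r hr] at hd
  have hr0 : r ≠ 0 := by
    rintro rfl
    simp at hq
  obtain ⟨R, hR, hrR⟩ : ∃ R : ℝ, |R| < Real.pi ∧ (0 < r ∧ r < R ∨ R < r ∧ r < 0) := by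
    rw [abs_lt] at hd
    rcases lt_or_gt_of_ne hr0 with h | h
    · exact ⟨(r - Real.pi) / 2, abs_lt.2 ⟨by linarith, by linarith⟩, .inr ⟨by linarith, h⟩⟩
    · exact ⟨(r + Real.pi) / 2, abs_lt.2 ⟨by linarith, by linarith⟩, .inl ⟨h, by linarith⟩⟩
  refine ⟨c + (R : ℝ), (hseg R r hR hr).2 hrR, ?_, ?_⟩
  · have himage : openMetricSegment c (c + (R : ℝ)) = (fun t : AddCircle (2 * Real.pi) => c + t) ''
        ((fun t : ℝ => (t : AddCircle (2 * Real.pi))) '' (Ioo 0 R ∪ Ioo R 0)) := by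
      ext q
      constructor
      · intro h
        obtain ⟨t, ht, rfl⟩ := hrep q
        exact ⟨t, ⟨t, (hseg R t hR ht).1 h, rfl⟩, rfl⟩
      · rintro ⟨_, ⟨t, ht, rfl⟩, rfl⟩
        refine (hseg R t hR ?_).2 ht
        have hR' := abs_lt.1 hR
        rw [abs_le]
        rcases ht with ⟨h1, h2⟩ | ⟨h1, h2⟩ <;> constructor <;> linarith
    rw [himage]
    exact (Homeomorph.addLeft c).isOpenMap _
      (QuotientAddGroup.isOpenMap_coe _ (isOpen_Ioo.union isOpen_Ioo))
  · intro q₁ h₁ q₂ h₂ h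
    obtain ⟨t₁, ht₁, rfl⟩ := hrep q₁
    obtain ⟨t₂, ht₂, rfl⟩ := hrep q₂
    rw [hseg R _ hR ht₁] at h₁
    rw [hseg R _ hR ht₂] at h₂
    simp only [hdist0 _ ht₁, hdist0 _ ht₂] at h
    congr 2
    rcases abs_cases t₁ with h3 | h3 <;> rcases abs_cases t₂ with h4 | h4 <;>
      rcases h₁ with h₁ | h₁ <;> rcases h₂ with h₂ | h₂ <;> linarith

end ModelSpaces

end CohomogeneityOne

namespace CohomogeneityOne

/-! ### The projection onto the orbit space -/

section OrbitProjection

variable {G : Type*} [Group G] {X : Type*} [MetricSpace X] [MulAction G X]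
  {Y : Type*} [MetricSpace Y]

variable (G) in
/-- `P : X → Y` realizes the metric space `Y` as the orbit space of `X`: it is onto, and distances
in `Y` are distances of orbits in `X`. -/
structure IsOrbitProjection (P : X → Y) : Prop where
  surjective : Function.Surjective P
  dist_eq : ∀ x y, dist (P x) (P y) = Metric.infDist x (MulAction.orbit G y)

theorem orbitDist_mk [IsIsometricSMul G X] (x y : X) :
    orbitDist G (Quotient.mk (MulAction.orbitRel G X) x) (Quotient.mk (MulAction.orbitRel G X) y) =
      Metric.infDist x (MulAction.orbit G y) := by
  have hx : x ∈ MulAction.orbitRel.Quotient.orbit (Quotient.mk (MulAction.orbitRel G X) x) :=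
    MulAction.mem_orbit_self x
  have hy : y ∈ MulAction.orbitRel.Quotient.orbit (Quotient.mk (MulAction.orbitRel G X) y) :=
    MulAction.mem_orbit_self y
  have : Nonempty
      ((MulAction.orbitRel.Quotient.orbit (Quotient.mk (MulAction.orbitRel G X) x)) ×
        (MulAction.orbitRel.Quotient.orbit (Quotient.mk (MulAction.orbitRel G X) y))) :=
    ⟨⟨x, hx⟩, ⟨y, hy⟩⟩
  apply le_antisymm
  · refine (Metric.le_infDist ⟨y, MulAction.mem_orbit_self y⟩).2 fun z hz => ?_
    exact ciInf_le (f := fun p : (MulAction.orbitRel.Quotient.orbit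
        (Quotient.mk (MulAction.orbitRel G X) x)) × (MulAction.orbitRel.Quotient.orbit
        (Quotient.mk (MulAction.orbitRel G X) y)) => dist (p.1 : X) (p.2 : X))
      ⟨0, by rintro _ ⟨p, rfl⟩; exact dist_nonneg⟩ (⟨x, hx⟩, ⟨z, hz⟩)
  · refine le_ciInf ?_
    rintro ⟨⟨_, ⟨g, rfl⟩⟩, ⟨_, ⟨k, rfl⟩⟩⟩
    have : dist (g • x) (k • y) = dist x ((g⁻¹ * k) • y) := by
      rw [mul_smul, ← dist_smul g⁻¹ (g • x), inv_smul_smul]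
    exact (Metric.infDist_le_dist_of_mem (MulAction.mem_orbit y (g⁻¹ * k))).trans this.ge

theorem OrbitSpaceIsometricTo.exists_isOrbitProjection [IsIsometricSMul G X]
    (h : OrbitSpaceIsometricTo G X Y) : ∃ P : X → Y, IsOrbitProjection G P := by
  obtain ⟨f, hf⟩ := h
  refine ⟨fun x => f (Quotient.mk (MulAction.orbitRel G X) x),
    f.surjective.comp Quotient.mk_surjective, fun x y => ?_⟩
  rw [hf, orbitDist_mk]

namespace IsOrbitProjection

variable {P : X → Y} (hP : IsOrbitProjection G P)
include hP

theorem dist_le (x y : X) : dist (P x) (P y) ≤ dist x y := by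
  rw [hP.dist_eq]
  exact Metric.infDist_le_dist_of_mem (MulAction.mem_orbit_self y)

theorem lipschitzWith : LipschitzWith 1 P :=
  LipschitzWith.of_dist_le_mul fun x y => by simpa using hP.dist_le x y

theorem apply_smul (g : G) (x : X) : P (g • x) = P x := by
  rw [← dist_eq_zero, hP.dist_eq]
  exact Metric.infDist_zero_of_mem (MulAction.mem_orbit x g)

variable [TopologicalSpace G] [CompactSpace G] [ContinuousSMul G X]

theorem exists_dist_eq (x y : X) : ∃ g : G, dist (P x) (P y) = dist x (g • y) := by
  have hcpt : IsCompact (MulAction.orbit G y) :=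
    isCompact_range (continuous_id.smul continuous_const)
  obtain ⟨_, ⟨g, rfl⟩, h⟩ := hcpt.exists_infDist_eq_dist ⟨y, MulAction.mem_orbit_self y⟩ x
  exact ⟨g, (hP.dist_eq x y).trans h⟩

theorem exists_smul_eq {x y : X} (h : P x = P y) : ∃ g : G, x = g • y := by
  obtain ⟨g, hg⟩ := hP.exists_dist_eq x y
  exact ⟨g, by rwa [h, dist_self, eq_comm, dist_eq_zero] at hg⟩

theorem exists_dist_le (x₀ : X) : ∃ C : ℝ, ∀ x, dist x x₀ ≤ dist (P x) (P x₀) + C := by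
  have hcpt : IsCompact (MulAction.orbit G x₀) :=
    isCompact_range (continuous_id.smul continuous_const)
  obtain ⟨C, hC⟩ := (Metric.isBounded_iff_subset_closedBall x₀).1 hcpt.isBounded
  refine ⟨C, fun x => ?_⟩
  obtain ⟨g, hg⟩ := hP.exists_dist_eq x x₀
  have h1 : dist (g • x₀) x₀ ≤ C := hC (MulAction.mem_orbit x₀ g)
  linarith [dist_triangle x (g • x₀) x₀]

end IsOrbitProjection

end OrbitProjection

/-! ### Geodesics parametrized by arc length -/

section Curves

variable {X : Type*} [MetricSpace X]

theorem IsGeodesicSpace.exists_unit_speed (hgeo : IsGeodesicSpace X) (x y : X) :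
    ∃ c : ℝ → X, c 0 = x ∧ c (dist x y) = y ∧
      ∀ s ∈ Icc 0 (dist x y), ∀ t ∈ Icc 0 (dist x y), dist (c s) (c t) = |s - t| := by
  rcases eq_or_ne x y with rfl | hxy
  · refine ⟨fun _ => x, rfl, rfl, fun s hs t ht => ?_⟩
    rw [dist_self, Icc_self, mem_singleton_iff] at hs ht
    simp [hs, ht]
  · obtain ⟨γ, h0, h1⟩ := hgeo x y
    have hpos : 0 < dist x y := dist_pos.2 hxy
    refine ⟨fun t => γ.1 (projIcc 0 1 zero_le_one (t / dist x y)), ?_, ?_, fun s hs t ht => ?_⟩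
    · simpa [Geo.eval] using h0
    · simpa [Geo.eval, div_self hpos.ne'] using h1
    · have hmem : ∀ r ∈ Icc 0 (dist x y), r / dist x y ∈ Icc (0 : ℝ) 1 := fun r hr =>
        ⟨div_nonneg hr.1 hpos.le, (div_le_one hpos).2 hr.2⟩
      have h0' : γ.1 0 = x := h0
      have h1' : γ.1 1 = y := h1
      rw [γ.2, projIcc_of_mem _ (hmem s hs), projIcc_of_mem _ (hmem t ht), h0', h1', ← sub_div,
        abs_div, abs_of_pos hpos, div_mul_cancel₀ _ hpos.ne']

/-- Two arc length geodesics that follow each other form a geodesic as soon as the end points are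
at distance the total length. -/
theorem dist_concat {D s : ℝ} (hs : s ∈ Icc 0 D) {c₁ c₂ : ℝ → X}
    (h₁ : ∀ a ∈ Icc 0 s, ∀ b ∈ Icc 0 s, dist (c₁ a) (c₁ b) = |a - b|)
    (h₂ : ∀ a ∈ Icc s D, ∀ b ∈ Icc s D, dist (c₂ a) (c₂ b) = |a - b|)
    (hc : c₁ s = c₂ s) (hD : D ≤ dist (c₁ 0) (c₂ D)) :
    ∀ a ∈ Icc 0 D, ∀ b ∈ Icc 0 D,
      dist (if a ≤ s then c₁ a else c₂ a) (if b ≤ s then c₁ b else c₂ b) = |a - b| := by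
  have key : ∀ a ∈ Icc 0 s, ∀ b ∈ Icc s D, dist (c₁ a) (c₂ b) = b - a := by
    intro a ha b hb
    have e1 := h₁ 0 ⟨le_rfl, hs.1⟩ a ha
    have e2 := h₁ a ha s ⟨hs.1, le_rfl⟩
    have e3 := h₂ s ⟨le_rfl, hs.2⟩ b hb
    have e4 := h₂ b hb D ⟨hs.2, le_rfl⟩
    rw [abs_of_nonpos (by linarith [ha.1, ha.2])] at e1 e2
    rw [abs_of_nonpos (by linarith [hb.1, hb.2])] at e3 e4
    have t1 := dist_triangle4 (c₁ 0) (c₁ a) (c₂ b) (c₂ D)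
    have t2 := dist_triangle (c₁ a) (c₁ s) (c₂ b)
    rw [hc] at e2 t2
    linarith
  intro a ha b hb
  split_ifs with h h' h'
  · exact h₁ a ⟨ha.1, h⟩ b ⟨hb.1, h'⟩
  · rw [key a ⟨ha.1, h⟩ b ⟨by linarith, hb.2⟩, abs_of_nonpos (by linarith)]
    ring
  · rw [dist_comm, key b ⟨hb.1, h'⟩ a ⟨by linarith, ha.2⟩, abs_of_nonneg (by linarith)]
  · exact h₂ a ⟨by linarith, ha.2⟩ b ⟨by linarith, hb.2⟩

/-- The point `(1 - t) a + t b` of the interval `[0, D]`. -/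
def segmentPoint {D : ℝ} (a b : Icc (0 : ℝ) D) (t : I) : Icc (0 : ℝ) D :=
  ⟨(1 - (t : ℝ)) * a + t * b, (convex_Icc (0 : ℝ) D) a.2 b.2 (by linarith [t.2.2]) t.2.1
    (by ring)⟩

theorem continuous_segmentPoint {D : ℝ} :
    Continuous fun p : (Icc (0 : ℝ) D × Icc (0 : ℝ) D) × I => segmentPoint p.1.1 p.1.2 p.2 := by
  refine Continuous.subtype_mk ?_ _
  fun_prop

/-- The piece between the parameters `a` and `b` of an arc length geodesic `c`, parametrized by
`[0, 1]`. -/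
def subGeodesic {D : ℝ} (c : Icc (0 : ℝ) D → X) (hc : Isometry c) (a b : Icc (0 : ℝ) D) : Geo X :=
  ⟨⟨fun t => c (segmentPoint a b t), hc.continuous.comp
      (continuous_segmentPoint.comp (Continuous.prodMk_right (a, b)))⟩, by
    intro s t
    simp only [ContinuousMap.coe_mk, hc.dist_eq, Subtype.dist_eq, Real.dist_eq, segmentPoint,
      ← abs_mul, Icc.coe_zero, Icc.coe_one]
    rw [← abs_neg]
    congr 1
    ring⟩

theorem subGeodesic_eval {D : ℝ} (c : Icc (0 : ℝ) D → X) (hc : Isometry c) (a b : Icc (0 : ℝ) D)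
    (t : I) : (subGeodesic c hc a b).eval t = c (segmentPoint a b t) := rfl

theorem segmentPoint_zero {D : ℝ} (a b : Icc (0 : ℝ) D) : segmentPoint a b 0 = a := by
  ext; simp [segmentPoint]

theorem segmentPoint_one {D : ℝ} (a b : Icc (0 : ℝ) D) : segmentPoint a b 1 = b := by
  ext; simp [segmentPoint]

theorem Geo.continuous_eval (t : I) : Continuous (Geo.eval t : Geo X → X) :=
  (continuous_eval_const t).comp continuous_subtype_val

/-- The piece of a geodesic that a group of isometries moves depends continuously on the group
element and on the end points. -/
theorem continuous_subGeodesic {G : Type*} [Group G] [TopologicalSpace G] [MulAction G X]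
    [ContinuousSMul G X] [IsIsometricSMul G X] {D : ℝ} (c : Icc (0 : ℝ) D → X) (hc : Isometry c) :
    Continuous fun p : G × (Icc (0 : ℝ) D × Icc (0 : ℝ) D) =>
      subGeodesic (fun t => p.1 • c t) ((isometry_smul X p.1).comp hc) p.2.1 p.2.2 := by
  refine Continuous.subtype_mk ?_ _
  refine ContinuousMap.continuous_of_continuous_uncurry _ ?_
  have h := continuous_segmentPoint (D := D)
  have hc' := hc.continuous
  change Continuous fun p : (G × (Icc (0 : ℝ) D × Icc (0 : ℝ) D)) × I =>
    p.1.1 • c (segmentPoint p.1.2.1 p.1.2.2 p.2)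
  exact (continuous_fst.comp continuous_fst).smul (hc'.comp (h.comp
    ((continuous_snd.comp continuous_fst).prodMk continuous_snd)))

end Curves

end CohomogeneityOne

namespace CohomogeneityOne

/-! ### Couplings -/

section Couplings

theorem IsCoupling.isProbabilityMeasure {X : Type*} [MetricSpace X] [MeasurableSpace X]
    {ρ : Measure (X × X)} {μ₀ μ₁ : Measure X} [IsProbabilityMeasure μ₀] (h : IsCoupling ρ μ₀ μ₁) :
    IsProbabilityMeasure ρ := by
  have h' : IsProbabilityMeasure (ρ.map Prod.fst) := by rw [h.1]; infer_instance
  exact Measure.isProbabilityMeasure_of_map Prod.fst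

/-- On a compact metric space the quadratic cost attains its minimum on couplings. -/
theorem exists_isOptimalCoupling {J : Type*} [MetricSpace J] [CompactSpace J] [MeasurableSpace J]
    [BorelSpace J] (ν₀ ν₁ : Measure J) [IsProbabilityMeasure ν₀] [IsProbabilityMeasure ν₁] :
    ∃ π : Measure (J × J), IsOptimalCoupling π ν₀ ν₁ := by
  let f : C(J × J, ℝ) := ⟨fun p => dist p.1 p.2 ^ 2, by fun_prop⟩
  let F : ProbabilityMeasure (J × J) → ℝ := fun ρ => ∫ p, f p ∂(ρ : Measure (J × J))
  have hF : Continuous F := by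
    rw [continuous_iff_continuousAt]
    intro ρ
    exact (ProbabilityMeasure.tendsto_iff_forall_integral_tendsto.1 Filter.tendsto_id)
      (BoundedContinuousFunction.mkOfCompact f)
  have hcost : ∀ ρ : ProbabilityMeasure (J × J),
      quadraticCost (ρ : Measure (J × J)) = ENNReal.ofReal (F ρ) := by
    intro ρ
    rw [ofReal_integral_eq_lintegral_ofReal]
    · refine lintegral_congr fun p => ?_
      rw [edist_dist, ← ENNReal.ofReal_pow dist_nonneg]
      rfl
    · exact BoundedContinuousFunction.integrable (ρ : Measure (J × J))
        (BoundedContinuousFunction.mkOfCompact f)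
    · exact Filter.Eventually.of_forall fun p => sq_nonneg _
  let p₀ : ProbabilityMeasure J := ⟨ν₀, inferInstance⟩
  let p₁ : ProbabilityMeasure J := ⟨ν₁, inferInstance⟩
  let K : Set (ProbabilityMeasure (J × J)) :=
    {ρ | ρ.map continuous_fst.measurable.aemeasurable = p₀} ∩
      {ρ | ρ.map continuous_snd.measurable.aemeasurable = p₁}
  have hK : IsClosed K :=
    (isClosed_eq (ProbabilityMeasure.continuous_map continuous_fst) continuous_const).inter
      (isClosed_eq (ProbabilityMeasure.continuous_map continuous_snd) continuous_const)
  have hmem : ∀ ρ : ProbabilityMeasure (J × J),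
      ρ ∈ K ↔ IsCoupling (ρ : Measure (J × J)) ν₀ ν₁ := fun ρ =>
    and_congr Subtype.ext_iff Subtype.ext_iff
  have hne : K.Nonempty := by
    refine ⟨⟨ν₀.prod ν₁, inferInstance⟩, (hmem _).2 ⟨?_, ?_⟩⟩
    · simp
    · simp
  obtain ⟨ρ, hρ, hmin⟩ := hK.isCompact.exists_isMinOn hne hF.continuousOn
  refine ⟨ρ, (hmem ρ).1 hρ, fun ρ' hρ' => ?_⟩
  have := hρ'.isProbabilityMeasure
  have h := hmin ((hmem ⟨ρ', this⟩).2 hρ')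
  rw [hcost ρ, show quadraticCost ρ' = ENNReal.ofReal (F ⟨ρ', this⟩) from hcost ⟨ρ', this⟩]
  exact ENNReal.ofReal_le_ofReal h

/-- A `1`-Lipschitz map does not increase the cost of a coupling. Hence a coupling with the same
cost as an optimal coupling of the images is optimal. -/
theorem isOptimalCoupling_of_lipschitzWith {X J : Type*} [MetricSpace X] [MeasurableSpace X]
    [BorelSpace X] [SecondCountableTopology X] [MetricSpace J] [MeasurableSpace J] [BorelSpace J]
    [SecondCountableTopology J] {h : X → J} (hh : LipschitzWith 1 h) {μ₀ μ₁ : Measure X}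
    {π : Measure (J × J)} (hπ : IsOptimalCoupling π (μ₀.map h) (μ₁.map h))
    {ρ : Measure (X × X)} (hρ : IsCoupling ρ μ₀ μ₁) (hcost : quadraticCost ρ ≤ quadraticCost π) :
    IsOptimalCoupling ρ μ₀ μ₁ := by
  have hm : Measurable h := hh.continuous.measurable
  refine ⟨hρ, fun ρ' hρ' => hcost.trans ((hπ.2 (ρ'.map (Prod.map h h)) ⟨?_, ?_⟩).trans ?_)⟩
  · rw [Measure.map_map measurable_fst (hm.prodMap hm), ← hρ'.1,
      Measure.map_map hm measurable_fst]
    rfl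
  · rw [Measure.map_map measurable_snd (hm.prodMap hm), ← hρ'.2,
      Measure.map_map hm measurable_snd]
    rfl
  · unfold quadraticCost
    rw [lintegral_map (by fun_prop) (hm.prodMap hm)]
    refine lintegral_mono fun p => ?_
    have := hh p.1 p.2
    rw [ENNReal.coe_one, one_mul] at this
    exact pow_le_pow_left' this 2

end Couplings

/-! ### Invariant measures -/

section Invariant

/-- An invariant probability measure is recovered from its image under `h` by spreading the points
`c (h x)` of the orbits uniformly over these orbits. -/
theorem map_smul_prod_map_eq {G X T : Type*} [Group G] [MeasurableSpace G] [MeasurableSpace X]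
    [MeasurableSpace T] [MulAction G X] [MeasurableSMul₂ G X] [MeasurableMul G]
    (l : Measure G) [IsProbabilityMeasure l] [l.IsMulRightInvariant]
    (μ : Measure X) [IsProbabilityMeasure μ] [SMulInvariantMeasure G X μ]
    {h : X → T} (hh : Measurable h) {c : T → X} (hc : Measurable c)
    (horb : ∀ᵐ x ∂μ, c (h x) ∈ MulAction.orbit G x) :
    (l.prod (μ.map h)).map (fun p => p.1 • c p.2) = μ := by
  have : IsProbabilityMeasure (μ.map h) := Measure.isProbabilityMeasure_map hh.aemeasurable
  ext A hA
  have hind : Measurable (A.indicator (1 : X → ℝ≥0∞)) := measurable_one.indicator hA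
  have hF : Measurable fun x : X => ∫⁻ g, A.indicator (1 : X → ℝ≥0∞) (g • x) ∂l :=
    Measurable.lintegral_prod_left'
      (f := fun p : G × X => A.indicator (1 : X → ℝ≥0∞) (p.1 • p.2))
      (hind.comp (measurable_fst.smul measurable_snd))
  have hF_inv : ∀ (k : G) (x : X), ∫⁻ g, A.indicator (1 : X → ℝ≥0∞) (g • k • x) ∂l =
      ∫⁻ g, A.indicator (1 : X → ℝ≥0∞) (g • x) ∂l := by
    intro k x
    simp only [← mul_smul]
    exact lintegral_mul_right_eq_self (μ := l)
      (fun g => A.indicator (1 : X → ℝ≥0∞) (g • x)) k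
  have hmeas : Measurable fun p : G × T => p.1 • c p.2 :=
    measurable_fst.smul (hc.comp measurable_snd)
  calc (l.prod (μ.map h)).map (fun p => p.1 • c p.2) A
      = ∫⁻ p, A.indicator (1 : X → ℝ≥0∞) (p.1 • c p.2) ∂(l.prod (μ.map h)) := by
        rw [← lintegral_indicator_one hA, lintegral_map hind hmeas]
    _ = ∫⁻ t, ∫⁻ g, A.indicator (1 : X → ℝ≥0∞) (g • c t) ∂l ∂(μ.map h) :=
        lintegral_prod_symm' _ (hind.comp hmeas)
    _ = ∫⁻ x, ∫⁻ g, A.indicator (1 : X → ℝ≥0∞) (g • c (h x)) ∂l ∂μ :=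
        lintegral_map (hF.comp hc) hh
    _ = ∫⁻ x, ∫⁻ g, A.indicator (1 : X → ℝ≥0∞) (g • x) ∂l ∂μ := by
        refine lintegral_congr_ae ?_
        filter_upwards [horb] with x hx
        obtain ⟨k, hk⟩ := hx
        rw [← hk]
        exact hF_inv k x
    _ = ∫⁻ g, ∫⁻ x, A.indicator (1 : X → ℝ≥0∞) (g • x) ∂μ ∂l :=
        lintegral_lintegral_swap
          (hind.comp (measurable_snd.smul measurable_fst)).aemeasurable
    _ = ∫⁻ _, μ A ∂l := by
        refine lintegral_congr fun g => ?_
        have := (measurePreserving_smul g μ).lintegral_comp hind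
        rw [this, lintegral_indicator_one hA]
    _ = μ A := by simp

/-- Conditioning an invariant measure on an invariant set gives an invariant measure. -/
theorem smulInvariantMeasure_cond {G X : Type*} [Group G] [MeasurableSpace X] [MulAction G X]
    [MeasurableConstSMul G X] (m : Measure X) [SMulInvariantMeasure G X m] {V : Set X}
    (hV : MeasurableSet V) (hinv : ∀ (g : G) (x : X), g • x ∈ V ↔ x ∈ V) :
    SMulInvariantMeasure G X (ProbabilityTheory.cond m V) := by
  refine ⟨fun g A hA => ?_⟩
  rw [ProbabilityTheory.cond_apply hV, ProbabilityTheory.cond_apply hV]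
  congr 1
  rw [← measure_preimage_smul m g (V ∩ A)]
  congr 1
  ext x
  simp [hinv]

/-- A compact group carries a right invariant probability measure. -/
theorem exists_isMulRightInvariant (G : Type*) [Group G] [TopologicalSpace G]
    [IsTopologicalGroup G] [CompactSpace G] [MeasurableSpace G] [BorelSpace G] :
    ∃ l : Measure G, IsProbabilityMeasure l ∧ l.IsMulRightInvariant := by
  let l : Measure G := Measure.haarMeasure ⊤
  have hl : IsProbabilityMeasure l := ⟨Measure.haarMeasure_self⟩
  exact ⟨l.inv, ⟨by simp [Measure.inv_apply]⟩, inferInstance⟩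

theorem memP2_cond {X : Type*} [MetricSpace X] [MeasurableSpace X] [BorelSpace X] (m : Measure X)
    {V : Set X} (hV : MeasurableSet V) (h0 : m V ≠ 0) (htop : m V ≠ ⊤) {x₀ : X} {R : ℝ}
    (hR : ∀ x ∈ V, dist x x₀ ≤ R) : MemP2 (ProbabilityTheory.cond m V) := by
  have := ProbabilityTheory.cond_isProbabilityMeasure_of_finite h0 htop
  refine ⟨this, x₀, ?_⟩
  calc ∫⁻ x, edist x x₀ ^ 2 ∂(ProbabilityTheory.cond m V)
      ≤ ∫⁻ _, ENNReal.ofReal R ^ 2 ∂(ProbabilityTheory.cond m V) := by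
        refine lintegral_mono_ae ?_
        filter_upwards [ProbabilityTheory.ae_cond_mem hV] with x hx
        rw [edist_dist]
        exact pow_le_pow_left' (ENNReal.ofReal_le_ofReal (hR x hx)) 2
    _ < ⊤ := by simp

end Invariant

end CohomogeneityOne

namespace CohomogeneityOne

/-! ### Branching geodesics of positive measure -/

section Branching

variable {X : Type*} [MetricSpace X] [SecondCountableTopology X] [MeasurableSpace X] [BorelSpace X]
  {G : Type*} [Group G] [TopologicalSpace G] [IsTopologicalGroup G]
  [SecondCountableTopology G] [MulAction G X] [ContinuousSMul G X] [IsIsometricSMul G X]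

/-- Moving the pieces of one geodesic `c` that crosses the level sets of `h` at unit speed by a
random group element, and choosing their end points by a coupling `π`, transports the invariant
measures `μ₀` and `μ₁` into each other at the cost of `π`. -/
theorem isCoupling_map_subGeodesic [MeasurableSpace G] [BorelSpace G] (l : Measure G)
    [IsProbabilityMeasure l] [l.IsMulRightInvariant] {D : ℝ} {c : Icc (0 : ℝ) D → X}
    (hc : Isometry c) {h : X → Icc (0 : ℝ) D} (hh : Measurable h) {μ₀ μ₁ : Measure X}
    [IsProbabilityMeasure μ₀] [IsProbabilityMeasure μ₁] [SMulInvariantMeasure G X μ₀]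
    [SMulInvariantMeasure G X μ₁] (h₀ : ∀ᵐ x ∂μ₀, c (h x) ∈ MulAction.orbit G x)
    (h₁ : ∀ᵐ x ∂μ₁, c (h x) ∈ MulAction.orbit G x)
    {π : Measure (Icc (0 : ℝ) D × Icc (0 : ℝ) D)} [IsProbabilityMeasure π]
    (hπ : IsCoupling π (μ₀.map h) (μ₁.map h)) :
    IsCoupling (((l.prod π).map fun p =>
        subGeodesic (fun t => p.1 • c t) ((isometry_smul X p.1).comp hc) p.2.1 p.2.2).map
          fun γ => (γ.eval 0, γ.eval 1)) μ₀ μ₁ ∧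
      quadraticCost (((l.prod π).map fun p =>
        subGeodesic (fun t => p.1 • c t) ((isometry_smul X p.1).comp hc) p.2.1 p.2.2).map
          fun γ => (γ.eval 0, γ.eval 1)) = quadraticCost π := by
  have hcm : Measurable c := hc.continuous.measurable
  have hE : Measurable fun γ : Geo X => (γ.eval 0, γ.eval 1) :=
    (Geo.continuous_eval 0).measurable.prodMk (Geo.continuous_eval 1).measurable
  have hpt : ∀ f : Icc (0 : ℝ) D × Icc (0 : ℝ) D → Icc (0 : ℝ) D, Measurable f →
      Measurable fun p : G × (Icc (0 : ℝ) D × Icc (0 : ℝ) D) => p.1 • c (f p.2) := fun f hf =>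
    measurable_fst.smul (hcm.comp (hf.comp measurable_snd))
  rw [Measure.map_map hE (continuous_subGeodesic c hc).measurable]
  have hcomp : (fun γ : Geo X => (γ.eval 0, γ.eval 1)) ∘
      (fun p : G × (Icc (0 : ℝ) D × Icc (0 : ℝ) D) =>
        subGeodesic (fun t => p.1 • c t) ((isometry_smul X p.1).comp hc) p.2.1 p.2.2) =
      fun p => (p.1 • c p.2.1, p.1 • c p.2.2) := by
    ext p : 1
    simp [subGeodesic_eval, segmentPoint_zero, segmentPoint_one]
  rw [hcomp]
  have hpair : Measurable fun p : G × (Icc (0 : ℝ) D × Icc (0 : ℝ) D) =>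
      (p.1 • c p.2.1, p.1 • c p.2.2) :=
    (hpt Prod.fst measurable_fst).prodMk (hpt Prod.snd measurable_snd)
  have hmarg : ∀ f : Icc (0 : ℝ) D × Icc (0 : ℝ) D → Icc (0 : ℝ) D, Measurable f →
      (l.prod π).map (fun p => p.1 • c (f p.2)) =
        (l.prod (π.map f)).map (fun p => p.1 • c p.2) := by
    intro f hf
    have : l.prod (π.map f) = (l.prod π).map (Prod.map id f) := by
      rw [← Measure.map_prod_map l π measurable_id hf, Measure.map_id]
    have hm : Measurable fun p : G × Icc (0 : ℝ) D => p.1 • c p.2 :=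
      measurable_fst.smul (hcm.comp measurable_snd)
    rw [this, Measure.map_map hm (measurable_id.prodMap hf)]
    rfl
  refine ⟨⟨?_, ?_⟩, ?_⟩
  · rw [Measure.map_map measurable_fst hpair]
    refine (hmarg Prod.fst measurable_fst).trans ?_
    rw [hπ.1]
    exact map_smul_prod_map_eq l μ₀ hh hcm h₀
  · rw [Measure.map_map measurable_snd hpair]
    refine (hmarg Prod.snd measurable_snd).trans ?_
    rw [hπ.2]
    exact map_smul_prod_map_eq l μ₁ hh hcm h₁
  · unfold quadraticCost
    rw [lintegral_map (by fun_prop) hpair]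
    simp only [edist_smul_left, hc.edist_eq]
    have hsnd : (l.prod π).map Prod.snd = π := by simp
    conv_rhs => rw [← hsnd]
    rw [lintegral_map (by fun_prop) measurable_snd]

/-- Two geodesics which agree for parameters at least `s`, which differ for parameters below `ε`,
and which both meet the orbits in an invariant set `V` of positive measure contradict the essential
non-branching of `m`: the optimal transport from `{h > s}` to `{h < ε}` inside `V` can be performed
along the translates of both. -/
theorem EssentiallyNonBranching.false_of_isometries [CompactSpace G] {m : Measure X}
    (henb : EssentiallyNonBranching m) [SMulInvariantMeasure G X m] {D : ℝ}
    {γ₁ γ₂ : Icc (0 : ℝ) D → X} (hγ₁ : Isometry γ₁) (hγ₂ : Isometry γ₂)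
    {h : X → Icc (0 : ℝ) D} (hh : LipschitzWith 1 h) (hinv : ∀ (g : G) (x : X), h (g • x) = h x)
    {V : Set X} (hV : MeasurableSet V) (hVinv : ∀ (g : G) (x : X), g • x ∈ V ↔ x ∈ V)
    (horb₁ : ∀ x ∈ V, γ₁ (h x) ∈ MulAction.orbit G x)
    (horb₂ : ∀ x ∈ V, γ₂ (h x) ∈ MulAction.orbit G x) {s ε : Icc (0 : ℝ) D}
    (heq : ∀ t, s ≤ t → γ₁ t = γ₂ t) (hne : ∀ t, t < ε → γ₁ t ≠ γ₂ t) {x₀ : X} {R : ℝ}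
    (hR : ∀ x ∈ V, dist x x₀ ≤ R) (hfin : m V ≠ ⊤) (hpos₀ : m (V ∩ {x | s < h x}) ≠ 0)
    (hpos₁ : m (V ∩ {x | h x < ε}) ≠ 0) : False := by
  have hhm : Measurable h := hh.continuous.measurable
  have hεs : ε ≤ s := not_lt.1 fun hlt => hne s hlt (heq s le_rfl)
  set V₀ : Set X := V ∩ {x | s < h x} with hV₀def
  set V₁ : Set X := V ∩ {x | h x < ε} with hV₁def
  have hV₀ : MeasurableSet V₀ := hV.inter (hhm measurableSet_Ioi)
  have hV₁ : MeasurableSet V₁ := hV.inter (hhm measurableSet_Iio)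
  have hfin₀ : m V₀ ≠ ⊤ := measure_ne_top_of_subset inter_subset_left hfin
  have hfin₁ : m V₁ ≠ ⊤ := measure_ne_top_of_subset inter_subset_left hfin
  set μ₀ := ProbabilityTheory.cond m V₀
  set μ₁ := ProbabilityTheory.cond m V₁
  have hP₀ : IsProbabilityMeasure μ₀ :=
    ProbabilityTheory.cond_isProbabilityMeasure_of_finite hpos₀ hfin₀
  have hP₁ : IsProbabilityMeasure μ₁ :=
    ProbabilityTheory.cond_isProbabilityMeasure_of_finite hpos₁ hfin₁
  have hinv₀ : SMulInvariantMeasure G X μ₀ :=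
    smulInvariantMeasure_cond m hV₀ fun g x => by simp [hV₀def, hVinv, hinv]
  have hinv₁ : SMulInvariantMeasure G X μ₁ :=
    smulInvariantMeasure_cond m hV₁ fun g x => by simp [hV₁def, hVinv, hinv]
  have hmem₀ : ∀ᵐ x ∂μ₀, x ∈ V₀ := ProbabilityTheory.ae_cond_mem hV₀
  have hmem₁ : ∀ᵐ x ∂μ₁, x ∈ V₁ := ProbabilityTheory.ae_cond_mem hV₁
  have hν₀ : IsProbabilityMeasure (μ₀.map h) := Measure.isProbabilityMeasure_map hhm.aemeasurable
  have hν₁ : IsProbabilityMeasure (μ₁.map h) := Measure.isProbabilityMeasure_map hhm.aemeasurable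
  obtain ⟨π, hπ⟩ := exists_isOptimalCoupling (μ₀.map h) (μ₁.map h)
  have hπP : IsProbabilityMeasure π := hπ.1.isProbabilityMeasure
  let mG : MeasurableSpace G := borel G
  have bG : BorelSpace G := ⟨rfl⟩
  obtain ⟨l, hl, hlinv⟩ := exists_isMulRightInvariant G
  obtain ⟨hc₁, hcost₁⟩ := isCoupling_map_subGeodesic l hγ₁ hhm
    (hmem₀.mono fun x hx => horb₁ x hx.1) (hmem₁.mono fun x hx => horb₁ x hx.1) hπ.1
  obtain ⟨hc₂, hcost₂⟩ := isCoupling_map_subGeodesic l hγ₂ hhm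
    (hmem₀.mono fun x hx => horb₂ x hx.1) (hmem₁.mono fun x hx => horb₂ x hx.1) hπ.1
  set Φ₁ := fun p : G × (Icc (0 : ℝ) D × Icc (0 : ℝ) D) =>
    subGeodesic (fun t => p.1 • γ₁ t) ((isometry_smul X p.1).comp hγ₁) p.2.1 p.2.2 with hΦ₁
  set Φ₂ := fun p : G × (Icc (0 : ℝ) D × Icc (0 : ℝ) D) =>
    subGeodesic (fun t => p.1 • γ₂ t) ((isometry_smul X p.1).comp hγ₂) p.2.1 p.2.2 with hΦ₂
  have mΦ₁ : Measurable Φ₁ := (continuous_subGeodesic γ₁ hγ₁).measurable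
  have mΦ₂ : Measurable Φ₂ := (continuous_subGeodesic γ₂ hγ₂).measurable
  have hE : Measurable fun γ : Geo X => (γ.eval 0, γ.eval 1) :=
    (Geo.continuous_eval 0).measurable.prodMk (Geo.continuous_eval 1).measurable
  have hp₁ : IsProbabilityMeasure ((l.prod π).map Φ₁) :=
    Measure.isProbabilityMeasure_map mΦ₁.aemeasurable
  have hp₂ : IsProbabilityMeasure ((l.prod π).map Φ₂) :=
    Measure.isProbabilityMeasure_map mΦ₂.aemeasurable
  -- Half of the mass moves along translates of `γ₁`, the other half along translates of `γ₂`.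
  set η : Measure (Geo X) := (2⁻¹ : ℝ≥0∞) • ((l.prod π).map Φ₁ + (l.prod π).map Φ₂) with hη
  have hhalf : ∀ a : ℝ≥0∞, 2⁻¹ * (a + a) = a := fun a => by
    rw [mul_add, ← add_mul, ENNReal.inv_two_add_inv_two, one_mul]
  have hhalf' : ∀ μ : Measure X, (2⁻¹ : ℝ≥0∞) • (μ + μ) = μ := fun μ => by
    ext A
    simp only [Measure.smul_apply, Measure.add_apply, smul_eq_mul, hhalf]
  have hopt : IsOptGeo η μ₀ μ₁ := by
    refine ⟨⟨?_⟩, isOptimalCoupling_of_lipschitzWith hh hπ ⟨?_, ?_⟩ ?_⟩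
    · simp only [hη, Measure.smul_apply, Measure.add_apply, measure_univ, smul_eq_mul, hhalf]
    · rw [hη, Measure.map_smul, Measure.map_smul, Measure.map_add _ _ hE,
        Measure.map_add _ _ measurable_fst, hc₁.1, hc₂.1, hhalf']
    · rw [hη, Measure.map_smul, Measure.map_smul, Measure.map_add _ _ hE,
        Measure.map_add _ _ measurable_snd, hc₁.2, hc₂.2, hhalf']
    · rw [hη, Measure.map_smul, Measure.map_add _ _ hE]
      unfold quadraticCost at hcost₁ hcost₂ ⊢
      rw [lintegral_smul_measure, lintegral_add_measure, hcost₁, hcost₂, smul_eq_mul, hhalf]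
  obtain ⟨Γ, hΓ, hηΓ⟩ := henb μ₀ μ₁ (memP2_cond m hV₀ hpos₀ hfin₀ fun x hx => hR x hx.1)
    (memP2_cond m hV₁ hpos₁ hfin₁ fun x hx => hR x hx.1)
    ProbabilityTheory.cond_absolutelyContinuous ProbabilityTheory.cond_absolutelyContinuous η hopt
  rw [hη, Measure.ae_ennreal_smul_measure_iff (by simp), ae_add_measure_iff] at hηΓ
  have hπ₀ : ∀ᵐ q ∂π, s < q.1 := by
    refine ae_of_ae_map measurable_fst.aemeasurable (p := fun t => s < t) ?_
    rw [hπ.1.1]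
    exact (ae_map_iff hhm.aemeasurable measurableSet_Ioi).2 (hmem₀.mono fun x hx => hx.2)
  have hπ₁ : ∀ᵐ q ∂π, q.2 < ε := by
    refine ae_of_ae_map measurable_snd.aemeasurable (p := fun t => t < ε) ?_
    rw [hπ.1.2]
    exact (ae_map_iff hhm.aemeasurable measurableSet_Iio).2 (hmem₁.mono fun x hx => hx.2)
  have hL : ∀ᵐ p ∂(l.prod π), s < p.2.1 ∧ p.2.2 < ε := by
    refine ae_of_ae_map measurable_snd.aemeasurable
      (p := fun q : Icc (0 : ℝ) D × Icc (0 : ℝ) D => s < q.1 ∧ q.2 < ε) ?_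
    rw [show (l.prod π).map Prod.snd = π by simp]
    exact hπ₀.and hπ₁
  obtain ⟨⟨g, a, b⟩, ⟨hsa, hbε⟩, hΓ₁, hΓ₂⟩ :=
    (hL.and ((ae_of_ae_map mΦ₁.aemeasurable hηΓ.1).and
      (ae_of_ae_map mΦ₂.aemeasurable hηΓ.2))).exists
  simp only at hsa hbε
  have hbs : (b : ℝ) < s := hbε.trans_le hεs
  have hsa' : (s : ℝ) < a := hsa
  -- The parameter at which the pieces from `a` to `b` reach `s`.
  have hba : (0 : ℝ) < a - b := by linarith
  let t₀ : I := ⟨((a : ℝ) - s) / (a - b), div_nonneg (by linarith) hba.le,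
    (div_le_one hba).2 (by linarith)⟩
  have hΦ : Φ₁ (g, a, b) = Φ₂ (g, a, b) := by
    refine hΓ _ hΓ₁ _ hΓ₂ ⟨t₀, ?_, ?_, fun t ht => ?_⟩
    · exact Subtype.coe_lt_coe.1 (div_pos (by linarith) hba)
    · exact Subtype.coe_lt_coe.1 ((div_lt_one hba).2 (by linarith))
    · simp only [hΦ₁, hΦ₂, subGeodesic_eval]
      rw [heq]
      have ht' : (t : ℝ) ≤ ((a : ℝ) - s) / (a - b) := ht
      rw [le_div_iff₀ hba] at ht'
      refine Subtype.coe_le_coe.1 ?_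
      simp only [segmentPoint]
      linarith
  have h1 := congrArg (Geo.eval 1) hΦ
  simp only [hΦ₁, hΦ₂, subGeodesic_eval, segmentPoint_one] at h1
  exact hne b hbε (MulAction.injective g h1)

end Branching

/-! ### Uniqueness of the nearest point on an orbit -/

section NearestPoint

variable {X : Type*} [MetricSpace X] {Y : Type*} [MetricSpace Y]
  {G : Type*} [Group G] [MulAction G X]

/-- A geodesic of `X` joining two orbits at distance its length projects to a geodesic of the
orbit space. -/
theorem IsOrbitProjection.dist_apply_of_isometry {P : X → Y} (hP : IsOrbitProjection G P)
    {D : ℝ} (hD : 0 ≤ D) {γ : Icc (0 : ℝ) D → X} (hγ : Isometry γ)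
    (h : D ≤ dist (P (γ ⟨0, le_rfl, hD⟩)) (P (γ ⟨D, hD, le_rfl⟩))) (t : Icc (0 : ℝ) D) :
    dist (P (γ ⟨0, le_rfl, hD⟩)) (P (γ t)) = t ∧
      dist (P (γ t)) (P (γ ⟨D, hD, le_rfl⟩)) = D - t := by
  have h1 := hP.dist_le (γ ⟨0, le_rfl, hD⟩) (γ t)
  have h2 := hP.dist_le (γ t) (γ ⟨D, hD, le_rfl⟩)
  rw [hγ.dist_eq, Subtype.dist_eq, Real.dist_eq, abs_of_nonpos (by linarith [t.2.1, t.2.2])]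
    at h1 h2
  simp only at h1 h2
  have h3 := dist_triangle (P (γ ⟨0, le_rfl, hD⟩)) (P (γ t)) (P (γ ⟨D, hD, le_rfl⟩))
  constructor <;> linarith

variable [SecondCountableTopology X] [MeasurableSpace X] [BorelSpace X]
  [TopologicalSpace G] [IsTopologicalGroup G] [CompactSpace G]
  [SecondCountableTopology G] [ContinuousSMul G X] [IsIsometricSMul G X]

/-- If the segment in the orbit space from an orbit to that of `y` can be extended, then `y` has
only one nearest point on the orbit: geodesics to two such points would branch at `y` when extended
beyond `y`. -/
theorem EssentiallyNonBranching.nearest_point_unique {m : Measure X} [m.IsOpenPosMeasure]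
    (hfin : ∀ (x : X) (r : ℝ), m (Metric.ball x r) < ⊤) (henb : EssentiallyNonBranching m)
    [SMulInvariantMeasure G X m] (hgeo : IsGeodesicSpace X) {P : X → Y}
    (hP : IsOrbitProjection G P) {w : Y} {x₁ x₂ y : X} (hx : P x₂ = P x₁)
    (hy : P y ∈ openMetricSegment (P x₁) w) (hopen : IsOpen (openMetricSegment (P x₁) w))
    (hinj : InjOn (dist (P x₁)) (openMetricSegment (P x₁) w))
    (h₁ : dist x₁ y = dist (P x₁) (P y)) (h₂ : dist x₂ y = dist (P x₁) (P y)) : x₁ = x₂ := by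
  by_contra hne
  set D := dist (P x₁) w with hDdef
  set s := dist (P x₁) (P y) with hsdef
  have hs0 : 0 < s := dist_pos.2 (Ne.symm hy.2.1)
  have hsD : s + dist (P y) w = D := hy.1
  have hyw : 0 < dist (P y) w := dist_pos.2 hy.2.2
  have hD : 0 ≤ D := dist_nonneg
  obtain ⟨z, hPz, hyz⟩ : ∃ z, P z = w ∧ dist y z = D - s := by
    obtain ⟨z, rfl⟩ := hP.surjective w
    obtain ⟨g, hg⟩ := hP.exists_dist_eq y z
    exact ⟨g • z, hP.apply_smul g z, by linarith⟩
  obtain ⟨c, hc0, hc1, hc⟩ := hgeo.exists_unit_speed y z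
  rw [hyz] at hc1 hc
  -- A nearest point of `y` is joined to `z` through `y` by a geodesic which beyond `y` is `c`.
  have hjoin : ∀ x, P x = P x₁ → dist x y = s → ∃ γ : Icc (0 : ℝ) D → X, Isometry γ ∧
      γ ⟨0, le_rfl, hD⟩ = x ∧ γ ⟨D, hD, le_rfl⟩ = z ∧
      ∀ t : Icc (0 : ℝ) D, s ≤ (t : ℝ) → γ t = c (t - s) := by
    intro x hPx hxy
    obtain ⟨c', hc'0, hc'1, hc'⟩ := hgeo.exists_unit_speed x y
    rw [hxy] at hc'1 hc'
    have hiso := dist_concat (D := D) (s := s) ⟨hs0.le, by linarith⟩ (c₁ := c')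
      (c₂ := fun t => c (t - s)) hc' (fun a ha b hb => by
        rw [hc _ ⟨by linarith [ha.1], by linarith [ha.2]⟩ _
          ⟨by linarith [hb.1], by linarith [hb.2]⟩, sub_sub_sub_cancel_right])
      (by simp only [sub_self, hc0, hc'1]) (by
        rw [hc'0, hc1, hDdef, ← hPz, ← hPx]
        exact hP.dist_le x z)
    refine ⟨fun t => if (t : ℝ) ≤ s then c' t else c (t - s), Isometry.of_dist_eq fun a b => ?_,
      ?_, ?_, fun t ht => ?_⟩
    · rw [hiso a a.2 b b.2, Subtype.dist_eq, Real.dist_eq]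
    · simp only [if_pos hs0.le, hc'0]
    · simp only [if_neg (not_le.2 (by linarith : s < D)), hc1]
    · rcases ht.eq_or_lt with h | h
      · simp only [← h, le_refl, if_true, sub_self, hc0, hc'1]
      · simp only [if_neg (not_le.2 h)]
  obtain ⟨γ₁, hγ₁, h0₁, hD₁, ht₁⟩ := hjoin x₁ rfl h₁
  obtain ⟨γ₂, hγ₂, h0₂, hD₂, ht₂⟩ := hjoin x₂ hx h₂
  let h : X → Icc (0 : ℝ) D := fun x => projIcc 0 D hD (dist (P x₁) (P x))
  have hh : LipschitzWith 1 h := by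
    have := (LipschitzWith.projIcc hD).comp
      ((LipschitzWith.dist_right (P x₁)).comp hP.lipschitzWith)
    rwa [one_mul, one_mul] at this
  have hcoord : ∀ γ : Icc (0 : ℝ) D → X, Isometry γ → P (γ ⟨0, le_rfl, hD⟩) = P x₁ →
      γ ⟨D, hD, le_rfl⟩ = z → ∀ t : Icc (0 : ℝ) D,
        dist (P x₁) (P (γ t)) = t ∧ dist (P (γ t)) w = D - t := by
    intro γ hγ hγ0 hγD t
    have := hP.dist_apply_of_isometry hD hγ (by rw [hγ0, hγD, hPz]) t
    rwa [hγ0, hγD, hPz] at this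
  have hseg : ∀ γ : Icc (0 : ℝ) D → X, Isometry γ → P (γ ⟨0, le_rfl, hD⟩) = P x₁ →
      γ ⟨D, hD, le_rfl⟩ = z → ∀ t : Icc (0 : ℝ) D, 0 < (t : ℝ) → (t : ℝ) < D →
        P (γ t) ∈ openMetricSegment (P x₁) w := by
    intro γ hγ hγ0 hγD t ht0 htD
    obtain ⟨e1, e2⟩ := hcoord γ hγ hγ0 hγD t
    refine ⟨by rw [e1, e2]; ring, fun h => ?_, fun h => ?_⟩
    · rw [h, dist_self] at e1
      linarith
    · rw [h, dist_self] at e2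
      linarith
  have hval : ∀ x, P x ∈ openMetricSegment (P x₁) w →
      ((h x : ℝ) = dist (P x₁) (P x) ∧ 0 < (h x : ℝ) ∧ (h x : ℝ) < D) := by
    intro x hx'
    have e0 : 0 < dist (P x₁) (P x) := dist_pos.2 (Ne.symm hx'.2.1)
    have e1 : 0 < dist (P x) w := dist_pos.2 hx'.2.2
    have e2 : dist (P x₁) (P x) + dist (P x) w = D := hx'.1
    have e3 : (h x : ℝ) = dist (P x₁) (P x) := by
      simp only [h, projIcc_of_mem hD (show dist (P x₁) (P x) ∈ Icc 0 D from
        ⟨e0.le, by linarith⟩)]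
    exact ⟨e3, by linarith, by linarith⟩
  have horb : ∀ γ : Icc (0 : ℝ) D → X, Isometry γ → P (γ ⟨0, le_rfl, hD⟩) = P x₁ →
      γ ⟨D, hD, le_rfl⟩ = z → ∀ x ∈ P ⁻¹' openMetricSegment (P x₁) w,
        γ (h x) ∈ MulAction.orbit G x := by
    intro γ hγ hγ0 hγD x hx'
    obtain ⟨e1, e2, e3⟩ := hval x hx'
    have := hinj (hseg γ hγ hγ0 hγD (h x) e2 e3) hx'
      (((hcoord γ hγ hγ0 hγD (h x)).1).trans e1)
    obtain ⟨g, hg⟩ := hP.exists_smul_eq this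
    exact ⟨g, hg.symm⟩
  -- By continuity `γ₁` and `γ₂` differ not only at `0` but for all small parameters.
  obtain ⟨ε, hε0, hε⟩ : ∃ ε : Icc (0 : ℝ) D, 0 < (ε : ℝ) ∧ ∀ t, t < ε → γ₁ t ≠ γ₂ t := by
    have hnhds : ∀ᶠ t in nhds (⟨0, le_rfl, hD⟩ : Icc (0 : ℝ) D), γ₁ t ≠ γ₂ t :=
      (isOpen_ne_fun hγ₁.continuous hγ₂.continuous).mem_nhds (by
        rw [mem_ofPred_eq, h0₁, h0₂]
        exact hne)
    obtain ⟨ε, hε, hball⟩ := Metric.eventually_nhds_iff.1 hnhds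
    refine ⟨⟨min ε D, le_min hε.le hD, min_le_right _ _⟩, lt_min hε (by linarith), fun t ht => ?_⟩
    apply hball
    have ht' : (t : ℝ) < min ε D := ht
    rw [Subtype.dist_eq, Real.dist_eq, sub_zero, abs_of_nonneg t.2.1]
    exact ht'.trans_le (min_le_left _ _)
  have hVopen : IsOpen (P ⁻¹' openMetricSegment (P x₁) w) :=
    hopen.preimage hP.lipschitzWith.continuous
  obtain ⟨C, hC⟩ := hP.exists_dist_le x₁
  have hR : ∀ x ∈ P ⁻¹' openMetricSegment (P x₁) w, dist x x₁ ≤ D + C := by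
    intro x hx'
    obtain ⟨e1, e2, e3⟩ := hval x hx'
    have := hC x
    rw [dist_comm (P x)] at this
    linarith
  have hpoint : ∀ t : Icc (0 : ℝ) D, 0 < (t : ℝ) → (t : ℝ) < D →
      γ₁ t ∈ P ⁻¹' openMetricSegment (P x₁) w ∧ h (γ₁ t) = t := by
    intro t ht0 htD
    have e := hseg γ₁ hγ₁ (by rw [h0₁]) hD₁ t ht0 htD
    refine ⟨e, Subtype.ext ?_⟩
    rw [(hval _ e).1, (hcoord γ₁ hγ₁ (by rw [h0₁]) hD₁ t).1]
  refine henb.false_of_isometries (G := G) (V := P ⁻¹' openMetricSegment (P x₁) w)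
    (s := ⟨s, hs0.le, by linarith⟩) (ε := ε) hγ₁ hγ₂ hh
    (fun g x => by simp only [h, hP.apply_smul]) hVopen.measurableSet
    (fun g x => by rw [mem_preimage, mem_preimage, hP.apply_smul])
    (horb γ₁ hγ₁ (by rw [h0₁]) hD₁) (horb γ₂ hγ₂ (by rw [h0₂, hx]) hD₂)
    (fun t ht => (ht₁ t ht).trans (ht₂ t ht).symm) hε hR
    (measure_ne_top_of_subset (fun x hx' => ?_) (hfin x₁ (D + C + 1)).ne) ?_ ?_
  · exact Metric.mem_ball.2 ((hR x hx').trans_lt (by linarith))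
  · refine ((hVopen.inter (isOpen_Ioi.preimage hh.continuous)).measure_pos m ?_).ne'
    obtain ⟨e1, e2⟩ := hpoint ⟨(s + D) / 2, by linarith, by linarith⟩
      (by simp only; linarith) (by simp only; linarith)
    refine ⟨_, e1, ?_⟩
    rw [mem_preimage, e2, mem_Ioi, ← Subtype.coe_lt_coe]
    simp only
    linarith
  · refine ((hVopen.inter (isOpen_Iio.preimage hh.continuous)).measure_pos m ?_).ne'
    have := ε.2.2
    obtain ⟨e1, e2⟩ := hpoint ⟨ε / 2, by linarith, by linarith⟩
      (by simp only; linarith) (by simp only; linarith)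
    refine ⟨_, e1, ?_⟩
    rw [mem_preimage, e2, mem_Iio, ← Subtype.coe_lt_coe]
    simp only
    linarith

end NearestPoint

/-! ### Slices -/

section Slices

variable {X : Type*} [MetricSpace X] {Y : Type*} [MetricSpace Y]
  {G : Type*} [Group G] [MulAction G X]

theorem IsOrbitProjection.mem_normalBall_iff {P : X → Y} (hP : IsOrbitProjection G P) {x y : X}
    {δ : ℝ} : y ∈ normalBall G x δ ↔ dist y x = dist (P y) (P x) ∧ dist y x < δ := by
  rw [normalBall, mem_inter_iff, mem_ofPred_eq, Metric.mem_ball, dist_comm x y, hP.dist_eq]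

variable [TopologicalSpace G] [CompactSpace G] [ContinuousSMul G X] [IsIsometricSMul G X]

theorem IsOrbitProjection.mem_saturation_normalBall_iff {P : X → Y} (hP : IsOrbitProjection G P)
    {x y : X} {δ : ℝ} : y ∈ saturation G (normalBall G x δ) ↔ dist (P y) (P x) < δ := by
  constructor
  · rintro ⟨g, z, hz, rfl⟩
    rw [hP.mem_normalBall_iff] at hz
    rw [hP.apply_smul, ← hz.1]
    exact hz.2
  · intro h
    obtain ⟨g, hg⟩ := hP.exists_dist_eq y x
    have hd : dist (g⁻¹ • y) x = dist (P y) (P x) := by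
      rw [hg, ← dist_smul g, smul_inv_smul]
    refine ⟨g, g⁻¹ • y, hP.mem_normalBall_iff.2 ⟨?_, hd.trans_lt h⟩, (smul_inv_smul g y).symm⟩
    rw [hd, hP.apply_smul]

/-- The set of points near `x` whose distance to the orbit is realized at `x` is a slice as soon as
the nearest points on the orbit are unique. -/
theorem IsOrbitProjection.isSlice_normalBall {P : X → Y} (hP : IsOrbitProjection G P) {x : X}
    {δ : ℝ} (hδ : 0 < δ) (huniq : ∀ x' y, P x' = P x → dist (P x) (P y) < δ →
      dist x y = dist (P x) (P y) → dist x' y = dist (P x) (P y) → x = x') :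
    IsSlice G x (normalBall G x δ) := by
  have hcont := hP.lipschitzWith.continuous
  refine ⟨hP.mem_normalBall_iff.2 ⟨by simp, by simpa using hδ⟩,
    ⟨{y | dist y x = dist (P y) (P x)}, isClosed_eq (by fun_prop) (by fun_prop), ?_⟩, ?_, ?_, ?_,
    ?_⟩
  · ext y
    rw [mem_inter_iff, hP.mem_saturation_normalBall_iff, hP.mem_normalBall_iff, mem_ofPred_eq]
    exact and_congr_right fun h => by rw [h]
  · have : saturation G (normalBall G x δ) = {y | dist (P y) (P x) < δ} := by
      ext y
      exact hP.mem_saturation_normalBall_iff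
    rw [this]
    exact isOpen_lt (by fun_prop) continuous_const
  · rintro _ ⟨g, rfl⟩
    rw [hP.mem_saturation_normalBall_iff]
    simpa [hP.apply_smul] using hδ
  · ext y
    constructor
    · rintro ⟨g, hg, z, hz, rfl⟩
      rw [hP.mem_normalBall_iff] at hz ⊢
      have : dist (g • z) x = dist z x := by
        conv_lhs => rw [← MulAction.mem_stabilizer_iff.1 hg, dist_smul]
      rwa [this, hP.apply_smul]
    · intro hy
      exact ⟨1, one_mem _, y, hy, (one_smul G y).symm⟩
  · rintro g ⟨_, ⟨y, hy, rfl⟩, hgy⟩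
    simp only [hP.mem_normalBall_iff, hP.apply_smul] at hy hgy
    -- Both `x` and `g⁻¹ x` are nearest points of `y`.
    have := huniq (g⁻¹ • x) y (hP.apply_smul _ _) (by rw [dist_comm, ← hy.1]; exact hy.2)
      (by rw [dist_comm, hy.1, dist_comm])
      (by rw [← dist_smul g, smul_inv_smul, dist_comm, hgy.1, dist_comm])
    rw [MulAction.mem_stabilizer_iff]
    conv_lhs => rw [this, smul_inv_smul]

theorem EssentiallyNonBranching.exists_isSlice_normalBall [SecondCountableTopology X]
    [MeasurableSpace X] [BorelSpace X] [IsTopologicalGroup G] [SecondCountableTopology G]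
    {m : Measure X} [m.IsOpenPosMeasure] (hfin : ∀ (x : X) (r : ℝ), m (Metric.ball x r) < ⊤)
    (henb : EssentiallyNonBranching m) [SMulInvariantMeasure G X m] (hgeo : IsGeodesicSpace X)
    (hquot : OrbitSpaceIsometricTo G X Y) (hY : ∀ c : Y, HasExtendableSegments c) (x : X) :
    ∃ δ₀ : ℝ, 0 < δ₀ ∧ ∀ δ : ℝ, 0 < δ → δ < δ₀ → IsSlice G x (normalBall G x δ) := by
  obtain ⟨P, hP⟩ := hquot.exists_isOrbitProjection
  obtain ⟨δ₀, hδ₀, hext⟩ := hY (P x)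
  refine ⟨δ₀, hδ₀, fun δ hδ hδδ₀ => hP.isSlice_normalBall hδ fun x' y hx' hd h₁ h₂ => ?_⟩
  by_cases hy : P y = P x
  · rw [hy, dist_self, dist_eq_zero] at h₁ h₂
    rw [h₁, h₂]
  · obtain ⟨w, hw, hopen, hinj⟩ := hext (P y) hy (hd.trans hδδ₀)
    exact henb.nearest_point_unique hfin hgeo hP hx' hw hopen hinj h₁ h₂

end Slices

end CohomogeneityOne


theorem mainTheorem3
    {X : Type*} [MetricSpace X] [CompleteSpace X] [TopologicalSpace.SeparableSpace X]
    [MeasurableSpace X] [BorelSpace X]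
    (hgeo : CohomogeneityOne.IsGeodesicSpace X)
    (m : Measure X) [m.IsOpenPosMeasure]
    (hfin : ∀ (x : X) (r : ℝ), m (Metric.ball x r) < ⊤)
    (henb : CohomogeneityOne.EssentiallyNonBranching m)
    {n : ℕ} {G : Type*} [Group G] [TopologicalSpace G] [T2Space G] [CompactSpace G]
    [ChartedSpace (EuclideanSpace ℝ (Fin n)) G] [LieGroup (𝓡 n) ∞ G]
    [MulAction G X] [ContinuousSMul G X] [IsIsometricSMul G X] [SMulInvariantMeasure G X m]
    (hquot : CohomogeneityOne.OrbitSpaceIsometricTo G X (Set.Icc (-1 : ℝ) 1) ∨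
      CohomogeneityOne.OrbitSpaceIsometricTo G X (Set.Ici (0 : ℝ)) ∨
      CohomogeneityOne.OrbitSpaceIsometricTo G X ℝ ∨
      -- the unit circle with its arc length distance, as `ℝ` modulo `2π`
      CohomogeneityOne.OrbitSpaceIsometricTo G X (AddCircle (2 * Real.pi)))
    (x₀ : X) :
    ∃ δ₀ : ℝ, 0 < δ₀ ∧ ∀ δ : ℝ, 0 < δ → δ < δ₀ →
      CohomogeneityOne.IsSlice G x₀ (CohomogeneityOne.normalBall G x₀ δ) := by
  have : IsTopologicalGroup G := topologicalGroup_of_lieGroup (𝓡 n) ∞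
  have : SecondCountableTopology G :=
    ChartedSpace.secondCountable_of_sigmaCompact (EuclideanSpace ℝ (Fin n)) G
  have : SecondCountableTopology X := UniformSpace.secondCountable_of_separable X
  rcases hquot with h | h | h | h
  · exact henb.exists_isSlice_normalBall hfin hgeo h
      CohomogeneityOne.hasExtendableSegments_Icc x₀
  · exact henb.exists_isSlice_normalBall hfin hgeo h
      CohomogeneityOne.hasExtendableSegments_Ici x₀
  · exact henb.exists_isSlice_normalBall hfin hgeo h
      CohomogeneityOne.hasExtendableSegments_real x₀
  · exact henb.exists_isSlice_normalBall hfin hgeo h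
      CohomogeneityOne.hasExtendableSegments_addCircle x₀
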